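/- Let $q\ge 2$ and $a,b\ge 0$ be fixed integers and let $s=a+b$. For a string $x$ of length $n$ over the alphabet $\{0,\dots,q-1\}$, let $S_{a,b}(x)$ be the set of strings $w$ of length $n-a+b$ such that some string $z$ of length $n-a$ is a (not necessarily contiguous) subsequence of both $x$ and $w$ (so $S_{a,b}(x)=\varnothing$ if $n<a$). A $q$-ary $n$-symbol $a$-deletion $b$-insertion correcting code is a set $C$ of strings of length $n$ over this alphabet such that $S_{a,b}(x)\cap S_{a,b}(y)=\varnothing$ for all distinct $x,y\in C$; when $b=0$ it is called an $a$-deletion correcting code. Let $A_q(n;a,b)$ be the largest number of elements of such a code, and write $f(n)\lesssim g(n)$ for $\limsup_{n\to\infty} f(n)/g(n)\le 1$. Then: 1. $\displaystyle A_q(n;a,b)\lesssim \frac{q^{n+b}}{(q-1)^s\binom{n}{s}\binom{s}{b}}$ as $n\to\infty$. 2. For every $n\ge s$, a set of strings of length $n$ is an $a$-deletion $b$-insertion correcting code if and only if it is an $s$-deletion correcting code. Consequently the bound in 1 also holds for $s$-deletion correcting codes: $\displaystyle A_q(n;s,0)\lesssim \frac{q^{n+b}}{(q-1)^s\binom{n}{s}\binom{s}{b}}$.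 3. In particular (no insertions) Levenshtein's bound $\displaystyle A_q(n;s,0)\lesssim \frac{q^{n}}{(q-1)^s\binom{n}{s}}$ holds. If $s>q$, then the bound with one insertion and $s-1$ deletions is strictly smaller than Levenshtein's: $\displaystyle \frac{q^{n+1}}{(q-1)^s\binom{n}{s}\binom{s}{1}}<\frac{q^{n}}{(q-1)^s\binom{n}{s}}$ for all $n\ge s$. -/

import Mathlib

noncomputable section

/-- The strings obtained from `x` by exactly `s` deletions: the (not necessarily contiguous)
subsequences of `x` of length `|x| - s`. This is empty when `|x| < s`. -/
def deletionSet {α : Type*} (s : ℕ) (x : List α) : Set (List α) :=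
  {z | z.length + s = x.length ∧ z.Sublist x}

/-- The strings obtained from `x` by exactly `s` insertions: the supersequences of `x` of
length `|x| + s`. -/
def insertionSet {α : Type*} (s : ℕ) (x : List α) : Set (List α) :=
  {w | w.length = x.length + s ∧ x.Sublist w}

/-- The possible outputs of the `a`-deletion `b`-insertion channel on input `x`. -/
def deletionInsertionSet {α : Type*} (a b : ℕ) (x : List α) : Set (List α) :=
  ⋃ z ∈ deletionSet a x, insertionSet b z

/-- `C` is a `q`-ary `n`-symbol `a`-deletion `b`-insertion correcting code. -/
def IsCorrectingCode (q n a b : ℕ) (C : Finset (List.Vector (Fin q) n)) : Prop :=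
  ∀ x ∈ C, ∀ y ∈ C, x ≠ y →
    Disjoint (deletionInsertionSet a b x.toList) (deletionInsertionSet a b y.toList)

open scoped Classical in
/-- The largest number of codewords in a `q`-ary `n`-symbol `a`-deletion `b`-insertion
correcting code. -/
def maxCodeSize (q n a b : ℕ) : ℕ :=
  ((Finset.univ : Finset (Finset (List.Vector (Fin q) n))).filter
    (IsCorrectingCode q n a b)).sup Finset.card

/-- `f n ≲ g n`: the ratio `f n / g n` is asymptotically at most one. -/
def AsympLE (f g : ℕ → ℝ) : Prop :=
  Filter.limsup (fun n => ((f n / g n : ℝ) : EReal)) Filter.atTop ≤ 1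

/-- The quantity `q ^ (n + b) / ((q - 1) ^ s * (n choose s) * (s choose b))`. -/
def codeBound (q s b n : ℕ) : ℝ :=
  (q : ℝ) ^ (n + b) / (((q : ℝ) - 1) ^ s * (n.choose s : ℝ) * (s.choose b : ℝ))

theorem IsCorrectingCode.card_le_maxCodeSize {q n a b : ℕ}
    {C : Finset (List.Vector (Fin q) n)} (hC : IsCorrectingCode q n a b C) :
    C.card ≤ maxCodeSize q n a b := by
  classical
  unfold maxCodeSize
  exact Finset.le_sup (f := Finset.card) (by simpa using hC)

end

/-! The bound is a packing argument. Outputs of distinct codewords are disjoint sets of strings of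
length `n - a + b`, so the point is to bound each output set from below. Reading `x` from the left,
the first symbol `c` is copied, preceded by an inserted `e ≠ c`, or, if a different symbol follows,
deleted. After each error a stretch of about `L` symbols is copied. The three families can then
collide only if `x` has period two on `L + 2` symbols. Without such stretches, Pascal's rule in both
binomials gives at least `(q - 1) ^ b` times about `changes x` choose `a` times `n` choose `b`
outputs, up to a loss of `L + 2` per error (`NoAlternation.le_ncard_deletionInsertionSet`). Take `L
= √n`. Strings with a periodic stretch are a fraction at most `n * q ^ (-√n)`. A typical string has
about `ρ * n` changes, `ρ = (q - 1) / q`, and a Chernoff bound makes those below `(ρ - δ) * n`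
exponentially rare. The exceptional codewords are negligible; packing the others and letting `δ → 0`
gives the bound. The equivalence of codes trades insertions for deletions: two subsequences of a
string share a long subsequence, and two superstrings of a string share a short superstring. The
final comparison holds because one insertion changes the bound by the factor `q / s`. -/

/-! ### Trading insertions for deletions -/

section Subsequences

variable {α : Type*}

/-- Two subsequences of `w` share a long common subsequence. -/
theorem List.Sublist.exists_common_sublist {z₁ z₂ w : List α} (h₁ : z₁.Sublist w)
    (h₂ : z₂.Sublist w) :
    ∃ u : List α, u.Sublist z₁ ∧ u.Sublist z₂ ∧ z₁.length + z₂.length ≤ w.length + u.length := by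
  induction h₁ generalizing z₂ with
  | slnil => exact ⟨[], by simp, by simp, by simpa using h₂.length_le⟩
  | @cons l₁ l₂ c h ih =>
    cases h₂ with
    | cons _ h' =>
      obtain ⟨u, hu₁, hu₂, hu⟩ := ih h'
      exact ⟨u, hu₁, hu₂, by simp; omega⟩
    | @cons_cons l₃ _ _ h' =>
      obtain ⟨u, hu₁, hu₂, hu⟩ := ih h'
      exact ⟨u, hu₁, hu₂.cons _, by simp; omega⟩
  | @cons_cons l₁ l₂ c h ih =>
    cases h₂ with
    | cons _ h' =>
      obtain ⟨u, hu₁, hu₂, hu⟩ := ih h'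
      exact ⟨u, hu₁.cons _, hu₂, by simp; omega⟩
    | @cons_cons l₃ _ _ h' =>
      obtain ⟨u, hu₁, hu₂, hu⟩ := ih h'
      exact ⟨c :: u, hu₁.cons_cons _, hu₂.cons_cons _, by simp; omega⟩

/-- Two supersequences of `u` share a short common supersequence. -/
theorem List.Sublist.exists_common_superlist {u z₁ z₂ : List α} (h₁ : u.Sublist z₁)
    (h₂ : u.Sublist z₂) :
    ∃ w : List α, z₁.Sublist w ∧ z₂.Sublist w ∧ w.length + u.length = z₁.length + z₂.length := by
  induction h₁ generalizing z₂ with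
  | slnil => exact ⟨z₂, by simp, List.Sublist.refl _, by simp⟩
  | @cons l₁ l₂ c h ih =>
    obtain ⟨w, hw₁, hw₂, hw⟩ := ih h₂
    exact ⟨c :: w, hw₁.cons_cons _, hw₂.cons _, by simp; omega⟩
  | @cons_cons l₁ l₂ c h ih =>
    obtain ⟨r₁, r₂, rfl, hc, hr⟩ := List.cons_sublist_iff.1 h₂
    obtain ⟨w, hw₁, hw₂, hw⟩ := ih hr
    refine ⟨r₁ ++ w, ?_, hw₂.append_left _, by simp; omega⟩
    exact List.Sublist.append (List.singleton_sublist.2 hc) hw₁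

/-- Between a subsequence and the whole list there are lists of every intermediate length. -/
theorem List.Sublist.exists_between_length {u x : List α} (h : u.Sublist x) {k : ℕ}
    (h₁ : u.length ≤ k) (h₂ : k ≤ x.length) :
    ∃ z : List α, u.Sublist z ∧ z.Sublist x ∧ z.length = k := by
  induction h generalizing k with
  | slnil => exact ⟨[], by simp, by simp, by simp at *; omega⟩
  | @cons l₁ l₂ c h ih =>
    by_cases hk : k ≤ l₂.length
    · obtain ⟨z, hz₁, hz₂, hz⟩ := ih h₁ hk
      exact ⟨z, hz₁, hz₂.cons _, hz⟩
    · exact ⟨c :: l₂, h.cons _, List.Sublist.refl _, by simp at *; omega⟩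
  | @cons_cons l₁ l₂ c h ih =>
    simp only [List.length_cons] at h₁ h₂
    obtain ⟨z, hz₁, hz₂, hz⟩ := ih (k := k - 1) (by omega) (by omega)
    exact ⟨c :: z, hz₁.cons_cons _, hz₂.cons_cons _, by simp; omega⟩

theorem mem_deletionInsertionSet {a b : ℕ} {x w : List α} :
    w ∈ deletionInsertionSet a b x ↔
      ∃ z : List α, z.length + a = x.length ∧ z.Sublist x ∧ w.length = z.length + b ∧
        z.Sublist w := by
  simp only [deletionInsertionSet, deletionSet, insertionSet, Set.mem_iUnion, Set.mem_ofPred_eq,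
    exists_prop, and_assoc]

/-- Outputs of the `a`-deletion `b`-insertion channel on equally long inputs can coincide exactly
when outputs of the `(a + b)`-deletion channel can. -/
theorem disjoint_deletionInsertionSet_iff {a b : ℕ} {x y : List α} (hxy : x.length = y.length)
    (hx : a + b ≤ x.length) :
    Disjoint (deletionInsertionSet a b x) (deletionInsertionSet a b y) ↔
      Disjoint (deletionInsertionSet (a + b) 0 x) (deletionInsertionSet (a + b) 0 y) := by
  rw [← not_iff_not, Set.not_disjoint_iff, Set.not_disjoint_iff]
  simp only [mem_deletionInsertionSet]
  constructor
  · rintro ⟨w, ⟨z₁, h₁, h₁x, hw₁, h₁w⟩, ⟨z₂, h₂, h₂y, hw₂, h₂w⟩⟩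
    -- With `n = x.length`, `u` has length at least `2(n - a) - (n - a + b) = n - (a + b)`;
    -- truncation makes this exact.
    obtain ⟨u, hu₁, hu₂, hu⟩ := h₁w.exists_common_sublist h₂w
    have hlen : (u.take (x.length - (a + b))).length = x.length - (a + b) := by
      simp; omega
    have ht := List.take_sublist (x.length - (a + b)) u
    exact ⟨_, ⟨_, by omega, (ht.trans hu₁).trans h₁x, rfl, List.Sublist.refl _⟩,
      ⟨_, by omega, (ht.trans hu₂).trans h₂y, rfl, List.Sublist.refl _⟩⟩
  · rintro ⟨w, ⟨z₁, h₁, h₁x, hw₁, h₁w⟩, ⟨z₂, h₂, h₂y, hw₂, h₂w⟩⟩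
    obtain rfl := h₁w.eq_of_length (by omega)
    obtain rfl := h₂w.eq_of_length (by omega)
    -- Growing the common subsequence to length `n - a` inside each input and merging gives length
    -- `2(n - a) - (n - a - b) = n - a + b`.
    obtain ⟨v₁, hv₁, hv₁x, hv₁l⟩ :=
      h₁x.exists_between_length (k := x.length - a) (by omega) (by omega)
    obtain ⟨v₂, hv₂, hv₂y, hv₂l⟩ :=
      h₂y.exists_between_length (k := x.length - a) (by omega) (by omega)
    obtain ⟨w, hw₁, hw₂, hw⟩ := hv₁.exists_common_superlist hv₂
    exact ⟨w, ⟨v₁, by omega, hv₁x, by omega, hw₁⟩, ⟨v₂, by omega, hv₂y, by omega, hw₂⟩⟩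

end Subsequences

theorem isCorrectingCode_iff_deletion {q n a b : ℕ} (hn : a + b ≤ n)
    (C : Finset (List.Vector (Fin q) n)) :
    IsCorrectingCode q n a b C ↔ IsCorrectingCode q n (a + b) 0 C := by
  unfold IsCorrectingCode
  refine forall₂_congr fun x _ => forall₂_congr fun y _ => imp_congr_right fun _ => ?_
  exact disjoint_deletionInsertionSet_iff (by simp) (by simpa using hn)

theorem maxCodeSize_eq_deletion {q n a b : ℕ} (hn : a + b ≤ n) :
    maxCodeSize q n a b = maxCodeSize q n (a + b) 0 := by
  have h : IsCorrectingCode q n a b = IsCorrectingCode q n (a + b) 0 :=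
    funext fun C => propext (isCorrectingCode_iff_deletion hn C)
  unfold maxCodeSize
  rw [h]

/-! ### Lower bound for the number of channel outputs -/

section Balls

variable {α : Type*}

theorem cons_mem_deletionInsertionSet {a b : ℕ} {x w : List α} (c : α)
    (h : w ∈ deletionInsertionSet a b x) : c :: w ∈ deletionInsertionSet a b (c :: x) := by
  rw [mem_deletionInsertionSet] at h ⊢
  obtain ⟨z, h₁, h₂, h₃, h₄⟩ := h
  exact ⟨c :: z, by simp; omega, h₂.cons_cons _, by simp; omega, h₄.cons_cons _⟩

theorem append_mem_deletionInsertionSet {a b : ℕ} {x w : List α} (p : List α)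
    (h : w ∈ deletionInsertionSet a b x) : p ++ w ∈ deletionInsertionSet a b (p ++ x) := by
  induction p with
  | nil => exact h
  | cons c p ih => exact cons_mem_deletionInsertionSet c ih

theorem insert_mem_deletionInsertionSet {a b : ℕ} {x w : List α} (e : α)
    (h : w ∈ deletionInsertionSet a b x) : e :: w ∈ deletionInsertionSet a (b + 1) x := by
  rw [mem_deletionInsertionSet] at h ⊢
  obtain ⟨z, h₁, h₂, h₃, h₄⟩ := h
  exact ⟨z, h₁, h₂, by simp; omega, h₄.cons _⟩

theorem delete_mem_deletionInsertionSet {a b : ℕ} {x w : List α} (c : α)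
    (h : w ∈ deletionInsertionSet a b x) : w ∈ deletionInsertionSet (a + 1) b (c :: x) := by
  rw [mem_deletionInsertionSet] at h ⊢
  obtain ⟨z, h₁, h₂, h₃, h₄⟩ := h
  exact ⟨z, by simp; omega, h₂.cons _, h₃, h₄⟩

/-- The number of places where consecutive symbols differ. -/
def changes [DecidableEq α] : List α → ℕ
  | c :: d :: l => (if c = d then 0 else 1) + changes (d :: l)
  | _ => 0

theorem changes_cons_le [DecidableEq α] (c : α) (l : List α) :
    changes (c :: l) ≤ changes l + 1 := by
  cases l with
  | nil => simp [changes]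
  | cons d l => simp only [changes]; split_ifs <;> omega

theorem changes_le_drop [DecidableEq α] (k : ℕ) (l : List α) :
    changes l ≤ changes (l.drop k) + k := by
  induction k generalizing l with
  | zero => simp
  | succ k ih =>
    cases l with
    | nil => simp [changes]
    | cons c l =>
      have := ih l
      have := changes_cons_le c l
      simp only [List.drop_succ_cons]; omega

theorem changes_le_length [DecidableEq α] (l : List α) : changes l ≤ l.length := by
  have := changes_le_drop l.length l
  simpa [changes] using this

/-- No stretch of `x` of length `L + 2` has period two. -/
def NoAlternation (L : ℕ) (x : List α) : Prop :=
  ∀ i, i + L + 2 ≤ x.length → (x.drop i).take L ≠ (x.drop (i + 2)).take L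

theorem NoAlternation.drop {L : ℕ} {x : List α} (h : NoAlternation L x) (k : ℕ) :
    NoAlternation L (x.drop k) := by
  intro i hi
  have hi' : k + i + L + 2 ≤ x.length := by
    simp only [List.length_drop] at hi; omega
  simpa [List.drop_drop, add_assoc] using h (k + i) hi'

theorem finite_deletionInsertionSet [Finite α] (a b : ℕ) (x : List α) :
    (deletionInsertionSet a b x).Finite := by
  refine (List.finite_length_eq α (x.length - a + b)).subset fun w hw => ?_
  obtain ⟨z, h₁, h₂, h₃, h₄⟩ := mem_deletionInsertionSet.1 hw
  simp only [Set.mem_ofPred_eq]; omega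

/-- Copying the first symbol, inserting a different symbol before it, and deleting it when it is
followed by a different symbol yield different outputs, provided that the next symbols are copied
and do not alternate. -/
theorem ncard_add_ncard_add_ncard_le [Fintype α] {L : ℕ} {c : α} {l : List α}
    {S T₀ T₁ T₂ : Set (List α)} (hS : S.Finite) (h₀ : ∀ w ∈ T₀, c :: w ∈ S)
    (h₁ : ∀ w ∈ T₁, ∀ e, e ≠ c → e :: ((c :: l).take L ++ w) ∈ S)
    (h₂ : ∀ w ∈ T₂, l.take (L + 1) ++ w ∈ S)
    (h : T₂.Nonempty → L + 1 ≤ l.length ∧ (∃ d l', l = d :: l' ∧ c ≠ d) ∧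
      (c :: l).take L ≠ ((c :: l).drop 2).take L) :
    T₀.ncard + (Fintype.card α - 1) * T₁.ncard + T₂.ncard ≤ S.ncard := by
  set f₀ : List α → List α := fun w => c :: w
  set f₁ : α × List α → List α := fun p => p.1 :: ((c :: l).take L ++ p.2)
  set f₂ : List α → List α := fun w => l.take (L + 1) ++ w
  have hf₀ : Function.Injective f₀ := fun u v huv => by simpa [f₀] using huv
  have hf₁ : Function.Injective f₁ := fun u v huv => by
    simp only [f₁, List.cons.injEq, List.append_cancel_left_eq] at huv
    exact Prod.ext huv.1 huv.2
  have hf₂ : Function.Injective f₂ := fun u v huv => by simpa [f₂] using huv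
  have hs₀ : f₀ '' T₀ ⊆ S := by rintro _ ⟨w, hw, rfl⟩; exact h₀ w hw
  have hs₁ : f₁ '' ({c}ᶜ ×ˢ T₁) ⊆ S := by
    rintro _ ⟨⟨e, w⟩, ⟨he, hw⟩, rfl⟩; exact h₁ w hw e he
  have hs₂ : f₂ '' T₂ ⊆ S := by rintro _ ⟨w, hw, rfl⟩; exact h₂ w hw
  have hd₁ : Disjoint (f₀ '' T₀) (f₁ '' ({c}ᶜ ×ˢ T₁)) := by
    rw [Set.disjoint_left]
    rintro _ ⟨u, hu, rfl⟩ ⟨⟨e, w⟩, ⟨he, hw⟩, hew⟩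
    simp only [f₀, f₁, List.cons.injEq] at hew
    exact he hew.1
  have hd₂ : Disjoint (f₀ '' T₀ ∪ f₁ '' ({c}ᶜ ×ˢ T₁)) (f₂ '' T₂) := by
    rw [Set.disjoint_left]
    rintro _ hv ⟨w, hw, rfl⟩
    obtain ⟨hL, ⟨d, l', rfl, hcd⟩, halt⟩ := h ⟨w, hw⟩
    rcases hv with ⟨u, hu, huw⟩ | ⟨⟨e, u⟩, ⟨he, hu⟩, huw⟩
    · simp only [f₀, f₂, List.take_succ_cons, List.cons_append, List.cons.injEq] at huw
      exact hcd huw.1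
    · simp only [f₁, f₂, List.take_succ_cons, List.cons_append, List.cons.injEq] at huw
      -- A collision forces `e = d`; the next `L` symbols then agree with those two places further
      -- on.
      refine halt (List.append_inj_left huw.2 ?_)
      simp only [List.length_cons] at hL
      simp only [List.length_take, List.length_cons, List.length_drop]
      omega
  have hc : (({c} : Set α)ᶜ).ncard = Fintype.card α - 1 := by
    rw [Set.ncard_compl, Set.ncard_singleton, Nat.card_eq_fintype_card]
  calc T₀.ncard + (Fintype.card α - 1) * T₁.ncard + T₂.ncard
      = (f₀ '' T₀).ncard + (f₁ '' ({c}ᶜ ×ˢ T₁)).ncard + (f₂ '' T₂).ncard := by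
        rw [Set.ncard_image_of_injective _ hf₀, Set.ncard_image_of_injective _ hf₁,
          Set.ncard_image_of_injective _ hf₂, Set.ncard_prod, hc]
    _ = (f₀ '' T₀ ∪ f₁ '' ({c}ᶜ ×ˢ T₁) ∪ f₂ '' T₂).ncard := by
        rw [Set.ncard_union_eq hd₂ ((hS.subset hs₀).union (hS.subset hs₁)) (hS.subset hs₂),
          Set.ncard_union_eq hd₁ (hS.subset hs₀) (hS.subset hs₁)]
    _ ≤ S.ncard := Set.ncard_le_ncard (Set.union_subset (Set.union_subset hs₀ hs₁) hs₂) hS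

/-- A lower bound for the number of outputs of the `a`-deletion `b`-insertion channel on inputs
without long alternating stretches. -/
theorem NoAlternation.le_ncard_deletionInsertionSet [Fintype α] [DecidableEq α] {L a b : ℕ}
    {x : List α} (hx : NoAlternation L x) :
    (Fintype.card α - 1) ^ b * (changes x - (L + 2) * (a + b)).choose a *
      (x.length - (L + 2) * (a + b)).choose b ≤ (deletionInsertionSet a b x).ncard := by
  induction hm : x.length using Nat.strong_induction_on generalizing x a b with
  | _ m ih =>
  subst hm
  by_cases hs : a + b = 0
  · obtain ⟨rfl, rfl⟩ : a = 0 ∧ b = 0 := by omega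
    have : x ∈ deletionInsertionSet 0 0 x := mem_deletionInsertionSet.2 ⟨x, by simp⟩
    simpa using Nat.succ_le_of_lt
      ((Set.ncard_pos (finite_deletionInsertionSet 0 0 x)).2 ⟨x, this⟩)
  obtain ⟨s, hs'⟩ : ∃ s, a + b = s + 1 := ⟨a + b - 1, by omega⟩
  have hKs : (L + 2) * (s + 1) = (L + 2) * s + L + 2 := by ring
  -- For short `x` both binomials have upper entry `0`, and one of them vanishes because `a + b >
  -- 0`.
  by_cases hlen : x.length ≤ (L + 2) * (a + b)
  · have h₁ : x.length - (L + 2) * (a + b) = 0 := by omega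
    have h₂ : changes x - (L + 2) * (a + b) = 0 := by
      have := changes_le_length x
      omega
    rw [h₁, h₂]
    rcases Nat.eq_zero_or_pos a with rfl | ha
    · rw [Nat.choose_eq_zero_of_lt (show 0 < b by omega)]; simp
    · rw [Nat.choose_eq_zero_of_lt ha]; simp
  push Not at hlen
  rw [hs', hKs] at hlen
  obtain ⟨c, d, l, rfl⟩ : ∃ c d l, x = c :: d :: l := by
    rcases x with _ | ⟨c, _ | ⟨d, l⟩⟩
    · simp at hlen
    · simp at hlen
    · exact ⟨c, d, l, rfl⟩
  have hlen' : (L + 2) * s + L < l.length := by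
    simp only [List.length_cons] at hlen; omega
  set Q := Fintype.card α - 1
  set x := c :: d :: l with hxdef
  have hxl : x.length = l.length + 2 := by simp [hxdef]
  obtain ⟨M, hM⟩ : ∃ M, x.length - (L + 2) * (a + b) = M + 1 :=
    ⟨x.length - (L + 2) * (a + b) - 1, by rw [hs', hKs]; omega⟩
  rw [hs', hKs] at hM
  set R := changes x - (L + 2) * (a + b) with hR
  set R' := changes (d :: l) - (L + 2) * (a + b) with hR'
  have hrr : changes x = (if c = d then 0 else 1) + changes (d :: l) := rfl
  have hR'R : R' ≤ R := by rw [hR, hR', hrr]; omega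
  have hRR' : R ≤ R' + 1 := by rw [hR, hR', hrr]; split_ifs <;> omega
  rw [hs', hKs] at hR hR'
  have ih₀ := ih (d :: l).length (by simp [hxdef]) (x := d :: l) (a := a) (b := b)
    (by simpa [hxdef] using hx.drop 1) rfl
  rw [← hs'] at hKs
  have hM₀ : (d :: l).length - (L + 2) * (a + b) = M := by
    simp only [List.length_cons]; omega
  rw [hM₀] at ih₀
  -- `e₁` is the second Pascal term, set to `0` when no insertion remains; `e₂` below plays this
  -- role for deletions, and is also `0` when `c = d`.
  obtain ⟨T₁, e₁, hT₁, he₁, hB₁⟩ : ∃ (T₁ : Set (List α)) (e₁ : ℕ),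
      (∀ w ∈ T₁, ∀ e, e ≠ c → e :: (x.take L ++ w) ∈ deletionInsertionSet a b x) ∧
      (M + 1).choose b = M.choose b + e₁ ∧ Q ^ b * R.choose a * e₁ ≤ Q * T₁.ncard := by
    rcases b with _ | b
    · exact ⟨∅, 0, by simp⟩
    · refine ⟨deletionInsertionSet a b (x.drop L), M.choose b, fun w hw e _ => ?_,
        by rw [Nat.choose_succ_succ, add_comm], ?_⟩
      · have := append_mem_deletionInsertionSet (x.take L) hw
        rw [List.take_append_drop] at this
        exact insert_mem_deletionInsertionSet e this
      -- For `L = 0` the two empty windows agree, contradicting `hx`; so dropping `L` symbols does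
      -- shorten `x`.
      · have hL : L ≠ 0 := by
          rintro rfl
          exact hx 0 (by omega) (by simp)
        have hs₁ : a + b = s := by omega
        have := ih (x.drop L).length (by simp only [List.length_drop]; omega) (x := x.drop L)
          (a := a) (b := b) (hx.drop L) rfl
        -- One error fewer lowers the subtracted amount by `L + 2`, which covers the at most `L`
        -- changes dropped.
        have hch := changes_le_drop L x
        rw [pow_succ', mul_assoc, mul_assoc, ← mul_assoc (Q ^ b)]
        refine Nat.mul_le_mul_left _ (le_trans ?_ this)
        rw [hs₁]
        gcongr
        · omega
        · simp only [List.length_drop]; omega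
  obtain ⟨T₂, e₂, hT₂, hne, he₂, hB₂⟩ : ∃ (T₂ : Set (List α)) (e₂ : ℕ),
      (∀ w ∈ T₂, (d :: l).take (L + 1) ++ w ∈ deletionInsertionSet a b x) ∧
      (T₂.Nonempty → c ≠ d) ∧
      R.choose a ≤ R'.choose a + e₂ ∧ Q ^ b * e₂ * M.choose b ≤ T₂.ncard := by
    by_cases hcd : c = d
    · refine ⟨∅, 0, by simp, by simp, ?_, by simp⟩
      rw [show R = R' by rw [hR, hR', hrr, if_pos hcd, zero_add]]; simp
    rcases a with _ | a
    · exact ⟨∅, 0, by simp⟩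
    refine ⟨deletionInsertionSet a b ((d :: l).drop (L + 1)), R'.choose a, fun w hw => ?_,
      fun _ => hcd, ?_, ?_⟩
    · have := append_mem_deletionInsertionSet ((d :: l).take (L + 1)) hw
      rw [List.take_append_drop] at this
      exact delete_mem_deletionInsertionSet c this
    · calc R.choose (a + 1) ≤ (R' + 1).choose (a + 1) := Nat.choose_le_choose _ hRR'
        _ = _ := by rw [Nat.choose_succ_succ, add_comm]
    · have hs₂ : a + b = s := by omega
      have := ih ((d :: l).drop (L + 1)).length (by simp; omega) (x := (d :: l).drop (L + 1))
        (a := a) (b := b) (by simpa [hxdef] using hx.drop (L + 2)) rfl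
      have hch := changes_le_drop (L + 1) (d :: l)
      refine le_trans ?_ this
      rw [hs₂]
      gcongr
      · omega
      · simp; omega
  have key := ncard_add_ncard_add_ncard_le (finite_deletionInsertionSet a b x)
    (fun w hw => cons_mem_deletionInsertionSet c hw) hT₁ hT₂ (fun hn => ⟨by simp; omega,
      ⟨d, l, rfl, hne hn⟩, by simpa [hxdef] using hx 0 (by omega)⟩)
  have hM₁ : x.length - (L + 2) * (a + b) = M + 1 := by omega
  rw [hM₁]
  refine le_trans ?_ key
  calc Q ^ b * R.choose a * (M + 1).choose b
      = Q ^ b * R.choose a * M.choose b + Q ^ b * R.choose a * e₁ := by rw [he₁]; ring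
    _ ≤ Q ^ b * (R'.choose a + e₂) * M.choose b + Q ^ b * R.choose a * e₁ := by gcongr
    _ = Q ^ b * R'.choose a * M.choose b + Q ^ b * R.choose a * e₁ +
          Q ^ b * e₂ * M.choose b := by ring
    _ ≤ _ := by gcongr

end Balls

/-! ### Packing the output sets -/

section Packing

theorem ncard_length_eq (α : Type*) [Fintype α] (m : ℕ) :
    {l : List α | l.length = m}.ncard = Fintype.card α ^ m := by
  rw [← card_vector (α := α) m, ← Nat.card_eq_fintype_card, ← Nat.card_coe_set_eq]
  rfl

theorem IsCorrectingCode.sum_ncard_le {q n a b : ℕ} {C : Finset (List.Vector (Fin q) n)}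
    (hC : IsCorrectingCode q n a b C) :
    ∑ x ∈ C, (deletionInsertionSet a b x.toList).ncard ≤ q ^ (n - a + b) := by
  classical
  have hfin := List.finite_length_eq (Fin q) (n - a + b)
  calc ∑ x ∈ C, (deletionInsertionSet a b x.toList).ncard
      = ∑ x ∈ C, (finite_deletionInsertionSet a b x.toList).toFinset.card :=
        Finset.sum_congr rfl fun x _ => Set.ncard_eq_toFinset_card _ _
    _ = (C.biUnion fun x => (finite_deletionInsertionSet a b x.toList).toFinset).card := by
        refine (Finset.card_biUnion fun x hx y hy hxy => ?_).symm
        rw [Function.onFun, Set.Finite.disjoint_toFinset]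
        exact hC x hx y hy hxy
    _ ≤ hfin.toFinset.card := by
        refine Finset.card_le_card fun w hw => ?_
        simp only [Finset.mem_biUnion, Set.Finite.mem_toFinset, mem_deletionInsertionSet] at hw
        obtain ⟨x, _, z, h₁, h₂, h₃, h₄⟩ := hw
        simp only [List.Vector.toList_length] at h₁
        simp only [Set.Finite.mem_toFinset, Set.mem_ofPred_eq]
        omega
    _ = q ^ (n - a + b) := by
        rw [← Set.ncard_eq_toFinset_card _ hfin, ncard_length_eq, Fintype.card_fin]

open scoped Classical in
/-- Codewords with few changes or long alternating stretches are counted separately, the others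
by packing. -/
theorem maxCodeSize_mul_le (q n a b L k : ℕ) :
    maxCodeSize q n a b *
        ((q - 1) ^ b * (k - (L + 2) * (a + b)).choose a * (n - (L + 2) * (a + b)).choose b) ≤
      (Finset.card {x : List.Vector (Fin q) n | ¬ NoAlternation L x.toList} +
        Finset.card {x : List.Vector (Fin q) n | changes x.toList < k}) *
          ((q - 1) ^ b * (k - (L + 2) * (a + b)).choose a *
            (n - (L + 2) * (a + b)).choose b) + q ^ (n - a + b) := by
  set N := (q - 1) ^ b * (k - (L + 2) * (a + b)).choose a * (n - (L + 2) * (a + b)).choose b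
  set A : Finset (List.Vector (Fin q) n) := {x | ¬ NoAlternation L x.toList}
  set B : Finset (List.Vector (Fin q) n) := {x | changes x.toList < k}
  obtain ⟨C, hC, hmax⟩ : ∃ C, IsCorrectingCode q n a b C ∧ maxCodeSize q n a b = C.card := by
    unfold maxCodeSize
    obtain ⟨C, hC, h⟩ := Finset.exists_mem_eq_sup
      ((Finset.univ : Finset (Finset (List.Vector (Fin q) n))).filter (IsCorrectingCode q n a b))
      ⟨∅, by simp [IsCorrectingCode]⟩ Finset.card
    exact ⟨C, by simpa using hC, h⟩
  set D := C \ (A ∪ B)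
  have hcard : C.card ≤ A.card + B.card + D.card := by
    have h₁ := Finset.card_le_card_sdiff_add_card (s := C) (t := A ∪ B)
    have h₂ := Finset.card_union_le A B
    simp only [D]
    omega
  have hD : D.card * N ≤ q ^ (n - a + b) := by
    have hDC : IsCorrectingCode q n a b D := fun x hx y hy =>
      hC x (Finset.sdiff_subset hx) y (Finset.sdiff_subset hy)
    refine le_trans ?_ hDC.sum_ncard_le
    rw [← smul_eq_mul]
    refine Finset.card_nsmul_le_sum _ _ _ fun x hx => ?_
    simp only [D, A, B, Finset.mem_sdiff, Finset.mem_union, Finset.mem_filter, Finset.mem_univ,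
      true_and, not_or, not_not, not_lt] at hx
    have h := hx.2.1.le_ncard_deletionInsertionSet (a := a) (b := b)
    rw [Fintype.card_fin, List.Vector.toList_length] at h
    refine le_trans ?_ h
    exact Nat.mul_le_mul_right _ (Nat.mul_le_mul_left _
      (Nat.choose_le_choose _ (Nat.sub_le_sub_right hx.2.2 _)))
  rw [hmax]
  calc C.card * N ≤ (A.card + B.card + D.card) * N := by gcongr
    _ = (A.card + B.card) * N + D.card * N := by ring
    _ ≤ _ := by gcongr

end Packing

/-! ### Counting the exceptional strings -/

section Tails

variable {α : Type*} [Fintype α]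

open scoped Classical in
theorem card_alternation_at_le (L i n : ℕ) (hi : i + L + 2 ≤ n) :
    Finset.card {x : List.Vector α n |
      (x.toList.drop i).take L = (x.toList.drop (i + 2)).take L} ≤
      Fintype.card α ^ (n - L) := by
  -- The `L` positions outside `P` are determined by the rest, since there the `j`-th symbol equals
  -- the `(j - 2)`-th.
  set P : Fin n → Prop := fun j => ¬ (i + 2 ≤ (j : ℕ) ∧ (j : ℕ) < i + 2 + L) with hP
  have hcard : Fintype.card {j // P j} = n - L := by
    rw [Fintype.card_subtype_compl, Fintype.card_fin, Fintype.card_subtype]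
    congr 1
    have : ((Finset.univ : Finset (Fin n)).filter
        fun j : Fin n => i + 2 ≤ (j : ℕ) ∧ (j : ℕ) < i + 2 + L).map Fin.valEmbedding =
        Finset.Ico (i + 2) (i + 2 + L) := by
      ext j
      simp only [Finset.mem_map, Finset.mem_filter, Finset.mem_univ, true_and, Finset.mem_Ico,
        Fin.valEmbedding_apply]
      exact ⟨by rintro ⟨j, h, rfl⟩; exact h, fun h => ⟨⟨j, by omega⟩, h, rfl⟩⟩
    rw [← Finset.card_map, this, Nat.card_Ico]
    omega
  rw [← hcard, ← Fintype.card_fun, ← Finset.card_univ]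
  refine Finset.card_le_card_of_injOn (fun x j => x.get j.1) (by simp) fun x hx y hy hxy => ?_
  simp only [Finset.coe_filter, Finset.mem_univ, true_and, Set.mem_ofPred_eq] at hx hy
  have per : ∀ z : List α, (z.drop i).take L = (z.drop (i + 2)).take L →
      ∀ j, i + 2 ≤ j → j < i + 2 + L → z[j]? = z[j - 2]? := by
    intro z hz j h₁ h₂
    have := congrArg (fun l : List α => l[j - (i + 2)]?) hz
    simp only [List.getElem?_take, List.getElem?_drop, if_pos (show j - (i + 2) < L by omega)]
      at this
    rw [show i + (j - (i + 2)) = j - 2 by omega, show i + 2 + (j - (i + 2)) = j by omega] at this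
    exact this.symm
  refine List.Vector.toList_injective (List.ext_getElem? fun j => ?_)
  induction j using Nat.strong_induction_on with
  | _ j ih =>
  by_cases hj : i + 2 ≤ j ∧ j < i + 2 + L
  · rw [per _ hx j hj.1 hj.2, per _ hy j hj.1 hj.2]
    exact ih (j - 2) (by omega)
  · by_cases hjn : j < n
    · have := congrFun hxy ⟨⟨j, hjn⟩, hj⟩
      simp only [List.Vector.get_eq_get_toList] at this
      rw [List.getElem?_eq_getElem (by simpa using hjn),
        List.getElem?_eq_getElem (by simpa using hjn)]
      simpa using this
    · rw [List.getElem?_eq_none (by simpa using hjn), List.getElem?_eq_none (by simpa using hjn)]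

open scoped Classical in
theorem card_not_noAlternation_le (L n : ℕ) :
    Finset.card {x : List.Vector α n | ¬ NoAlternation L x.toList} ≤
      n * Fintype.card α ^ (n - L) := by
  calc Finset.card {x : List.Vector α n | ¬ NoAlternation L x.toList}
      ≤ ((Finset.range (n - L - 1)).biUnion fun i => {x : List.Vector α n |
          (x.toList.drop i).take L = (x.toList.drop (i + 2)).take L}).card := by
        refine Finset.card_le_card fun x hx => ?_
        simp only [NoAlternation, Finset.mem_filter, Finset.mem_univ, true_and, not_forall,
          List.Vector.toList_length, not_not] at hx
        obtain ⟨i, hi, h⟩ := hx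
        simp only [Finset.mem_biUnion, Finset.mem_range, Finset.mem_filter, Finset.mem_univ,
          true_and]
        exact ⟨i, by omega, h⟩
    _ ≤ (Finset.range (n - L - 1)).card * Fintype.card α ^ (n - L) :=
        Finset.card_biUnion_le_card_mul _ _ _ fun i hi =>
          card_alternation_at_le L i n (by simp only [Finset.mem_range] at hi; omega)
    _ ≤ n * Fintype.card α ^ (n - L) := by
        rw [Finset.card_range]
        gcongr
        omega

theorem sum_pow_changes_ofFn_succ [DecidableEq α] (t : ℝ) (n : ℕ) (p : List α) :
    ∑ f : Fin (n + 1) → α, t ^ changes (p ++ List.ofFn f) =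
      ∑ d : α, ∑ f : Fin n → α, t ^ changes (p ++ d :: List.ofFn f) := by
  rw [← (Fin.consEquiv fun _ : Fin (n + 1) => α).sum_comp, Fintype.sum_prod_type]
  simp only [Fin.consEquiv, Equiv.coe_fn_mk, List.ofFn_cons]

/-- Whatever the previous symbol, the next one repeats it in one way (weight `1`) or differs in `q -
1` ways (weight `t`), so the sum factors. -/
theorem sum_pow_changes_cons [DecidableEq α] (t : ℝ) (n : ℕ) (c : α) :
    ∑ f : Fin n → α, t ^ changes (c :: List.ofFn f) =
      (1 + ((Fintype.card α : ℝ) - 1) * t) ^ n := by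
  induction n generalizing c with
  | zero => simp [changes]
  | succ n ih =>
    have hsum : ∑ d : α, t ^ (if c = d then 0 else 1) = 1 + ((Fintype.card α : ℝ) - 1) * t := by
      rw [← Finset.add_sum_erase _ _ (Finset.mem_univ c), if_pos rfl, pow_zero,
        Finset.sum_congr rfl (g := fun _ => t)
          (fun d hd => by rw [if_neg (Finset.ne_of_mem_erase hd).symm, pow_one]),
        Finset.sum_const, Finset.card_erase_of_mem (Finset.mem_univ c), nsmul_eq_mul,
        Finset.card_univ, Nat.cast_sub (Fintype.card_pos_iff.2 ⟨c⟩), Nat.cast_one]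
    have h := sum_pow_changes_ofFn_succ t n [c]
    simp only [List.cons_append, List.nil_append] at h
    rw [h]
    simp only [changes, pow_add, ← Finset.mul_sum, ih]
    rw [← Finset.sum_mul, hsum, pow_one, mul_comm]

theorem sum_pow_changes_le [DecidableEq α] [Nonempty α] {t : ℝ} (ht : 0 ≤ t) (n : ℕ) :
    ∑ x : List.Vector α n, t ^ changes x.toList ≤
      Fintype.card α * (1 + ((Fintype.card α : ℝ) - 1) * t) ^ n := by
  have hq : (1 : ℝ) ≤ Fintype.card α := by exact_mod_cast Fintype.card_pos
  rw [← (Equiv.vectorEquivFin α n).symm.sum_comp]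
  have : ∀ f : Fin n → α, ((Equiv.vectorEquivFin α n).symm f).toList = List.ofFn f := fun f =>
    List.Vector.toList_ofFn f
  simp only [this]
  cases n with
  | zero => simpa [changes] using hq
  | succ n =>
    have h := sum_pow_changes_ofFn_succ (α := α) t n []
    simp only [List.nil_append] at h
    rw [h]
    simp only [sum_pow_changes_cons]
    rw [Finset.sum_const, Finset.card_univ, nsmul_eq_mul]
    gcongr
    · nlinarith
    · exact n.le_succ

theorem card_changes_lt_mul_le [DecidableEq α] [Nonempty α] {t : ℝ} (ht : 0 ≤ t) (ht' : t ≤ 1)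
    (n k : ℕ) :
    (Finset.card {x : List.Vector α n | changes x.toList < k} : ℝ) * t ^ k ≤
      Fintype.card α * (1 + ((Fintype.card α : ℝ) - 1) * t) ^ n := by
  refine le_trans ?_ (sum_pow_changes_le ht n)
  rw [← nsmul_eq_mul]
  refine le_trans (Finset.card_nsmul_le_sum _ (fun x => t ^ changes x.toList) _ fun x hx => ?_)
    (Finset.sum_le_sum_of_subset_of_nonneg (Finset.subset_univ _) fun _ _ _ => by positivity)
  simp only [Finset.mem_filter, Finset.mem_univ, true_and] at hx
  exact pow_le_pow_of_le_one ht ht' hx.le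

end Tails

open Filter Topology

/-! ### Limits of binomials and square-root exponents -/

section Asymptotics

theorem tendsto_natSub_div {m r : ℕ → ℕ} {c : ℝ}
    (hm : Tendsto (fun n => (m n : ℝ) / n) atTop (𝓝 c))
    (hr : Tendsto (fun n => (r n : ℝ) / n) atTop (𝓝 0)) :
    Tendsto (fun n => ((m n - r n : ℕ) : ℝ) / n) atTop (𝓝 c) := by
  refine tendsto_of_tendsto_of_tendsto_of_le_of_le (by simpa using hm.sub hr) hm
    (fun n => ?_) (fun n => ?_)
  · dsimp only
    rw [← sub_div]
    gcongr
    rw [sub_le_iff_le_add]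
    exact_mod_cast le_tsub_add
  · dsimp only
    gcongr
    exact Nat.sub_le _ _

theorem tendsto_choose_div_pow {m : ℕ → ℕ} {c : ℝ}
    (hm : Tendsto (fun n => (m n : ℝ) / n) atTop (𝓝 c)) (j : ℕ) :
    Tendsto (fun n => ((m n).choose j : ℝ) / (n : ℝ) ^ j) atTop (𝓝 (c ^ j / j.factorial)) := by
  have h : Tendsto (fun n => ((m n).descFactorial j : ℝ) / (n : ℝ) ^ j) atTop (𝓝 (c ^ j)) := by
    induction j with
    | zero => simp
    | succ j ih =>
      have := (tendsto_natSub_div hm (r := fun _ => j)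
        (tendsto_const_div_atTop_nhds_zero_nat (j : ℝ))).mul ih
      rw [← pow_succ'] at this
      refine this.congr fun n => ?_
      rw [Nat.descFactorial_succ, Nat.cast_mul, pow_succ', mul_div_mul_comm]
  refine (h.div_const (j.factorial : ℝ)).congr fun n => ?_
  rw [Nat.descFactorial_eq_factorial_mul_choose, Nat.cast_mul]
  have : (j.factorial : ℝ) ≠ 0 := by positivity
  field_simp

theorem tendsto_sqrt_div : Tendsto (fun n : ℕ => (n.sqrt : ℝ) / n) atTop (𝓝 0) := by
  have h : Tendsto (fun n : ℕ => (Real.sqrt n)⁻¹) atTop (𝓝 0) :=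
    (Real.tendsto_sqrt_atTop.comp tendsto_natCast_atTop_atTop).inv_tendsto_atTop
  refine squeeze_zero (fun n => by positivity) (fun n => ?_) h
  rw [← Real.sqrt_div_self]
  gcongr
  exact Real.nat_sqrt_le_real_sqrt

theorem tendsto_sqrt_atTop : Tendsto Nat.sqrt atTop atTop :=
  tendsto_atTop.2 fun k => (eventually_ge_atTop (k * k)).mono fun _ h => Nat.le_sqrt.2 h

/-- Since `n ≤ (√n + 1) ^ 2`, this is a polynomial against an exponential in `√n + 1`. -/
theorem tendsto_pow_mul_inv_pow_sqrt {q : ℝ} (hq : 1 < q) (j : ℕ) :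
    Tendsto (fun n : ℕ => (n : ℝ) ^ j * (q⁻¹) ^ n.sqrt) atTop (𝓝 0) := by
  have hq0 : 0 < q := by linarith
  have h := tendsto_pow_const_mul_const_pow_of_abs_lt_one (2 * j) (r := q⁻¹)
    (by rw [abs_of_pos (by positivity)]; exact inv_lt_one_of_one_lt₀ hq)
  have h' := (h.comp ((tendsto_add_atTop_nat 1).comp tendsto_sqrt_atTop)).mul_const q
  rw [zero_mul] at h'
  refine squeeze_zero (fun n => by positivity) (fun n => ?_) h'
  simp only [Function.comp_apply]
  have hn : (n : ℝ) ≤ ((n.sqrt + 1 : ℕ) : ℝ) ^ 2 := by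
    exact_mod_cast (Nat.lt_succ_sqrt' n).le
  calc (n : ℝ) ^ j * q⁻¹ ^ n.sqrt ≤ (((n.sqrt + 1 : ℕ) : ℝ) ^ 2) ^ j * q⁻¹ ^ n.sqrt := by gcongr
    _ = _ := by
      rw [← pow_mul, pow_succ (q⁻¹)]
      field_simp

end Asymptotics

/-! ### Chernoff bound and the asymptotic estimate -/

section MainBound

/-- Strings with fewer changes than expected by a positive proportion are exponentially rare. -/
theorem exists_card_changes_lt_le {q : ℕ} (hq : 2 ≤ q) {δ : ℝ} (hδ : 0 < δ)
    (hδ' : δ < ((q : ℝ) - 1) / q) :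
    ∃ c θ : ℝ, 0 < θ ∧ θ < 1 ∧ ∀ n : ℕ,
      (Finset.card {x : List.Vector (Fin q) n |
        changes x.toList < ⌈(((q : ℝ) - 1) / q - δ) * n⌉₊} : ℝ) ≤ c * θ ^ n * (q : ℝ) ^ n := by
  have hq' : (2 : ℝ) ≤ q := by exact_mod_cast hq
  set ρ : ℝ := ((q : ℝ) - 1) / q with hρ
  have hρ1 : ρ < 1 := by rw [hρ, div_lt_one (by linarith)]; linarith
  have hqρ : (q : ℝ) - 1 = q * ρ := by rw [hρ]; field_simp
  -- Chernoff with `t = exp (-δ)`: `-κ` is `δ * (ρ - δ) - ρ * δ / (1 + δ)`, negative as `ρ < 1 < 1 +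
  -- δ`. The prefactor `exp δ` pays for the ceiling.
  set κ : ℝ := δ ^ 2 - ρ * δ ^ 2 / (1 + δ) with hκ
  have hκ0 : 0 < κ := by
    rw [hκ, sub_pos, div_lt_iff₀ (by linarith)]
    nlinarith [pow_pos hδ 2, pow_pos hδ 3]
  refine ⟨q * Real.exp δ, Real.exp (-κ), Real.exp_pos _, by simpa using hκ0, fun n => ?_⟩
  have : Nonempty (Fin q) := ⟨⟨0, by omega⟩⟩
  set k := ⌈(ρ - δ) * n⌉₊
  have hk : (k : ℝ) ≤ (ρ - δ) * n + 1 :=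
    (Nat.ceil_lt_add_one (mul_nonneg (by linarith) n.cast_nonneg)).le
  have h := card_changes_lt_mul_le (α := Fin q) (Real.exp_pos (-δ)).le
    (by simpa using hδ.le) n k
  rw [Fintype.card_fin] at h
  set E : ℝ := (Finset.card {x : List.Vector (Fin q) n | changes x.toList < k} : ℝ)
  have hbase : 1 + ((q : ℝ) - 1) * Real.exp (-δ) ≤ q * Real.exp (-(ρ * δ / (1 + δ))) := by
    have h₁ : Real.exp (-δ) ≤ 1 / (1 + δ) := by
      rw [Real.exp_neg, ← one_div]
      exact one_div_le_one_div_of_le (by linarith) (by linarith [Real.add_one_le_exp δ])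
    have h₂ := Real.add_one_le_exp (-(ρ * δ / (1 + δ)))
    have h₃ : ρ * (1 / (1 + δ)) = ρ - ρ * δ / (1 + δ) := by
      rw [eq_sub_iff_add_eq, mul_one_div, ← add_div, div_eq_iff (by linarith)]
      ring
    have h₄ : (q : ℝ) * ρ * Real.exp (-δ) ≤ q * ρ * (1 / (1 + δ)) := by
      have : 0 ≤ (q : ℝ) * ρ := by linarith
      gcongr
    calc 1 + ((q : ℝ) - 1) * Real.exp (-δ) = q - q * ρ + q * ρ * Real.exp (-δ) := by
          rw [← hqρ]; ring
      _ ≤ q - q * ρ + q * ρ * (1 / (1 + δ)) := by gcongr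
      _ = q * (-(ρ * δ / (1 + δ)) + 1) := by rw [mul_assoc, h₃]; ring
      _ ≤ _ := by gcongr
  have hpow : Real.exp (-δ) ^ k ≥ Real.exp (-(δ * ((ρ - δ) * n + 1))) := by
    rw [← Real.exp_nat_mul]
    apply Real.exp_le_exp.2
    nlinarith
  have hE : E * Real.exp (-(δ * ((ρ - δ) * n + 1))) ≤
      q * (q * Real.exp (-(ρ * δ / (1 + δ)))) ^ n :=
    calc _ ≤ E * Real.exp (-δ) ^ k := mul_le_mul_of_nonneg_left hpow (Nat.cast_nonneg _)
      _ ≤ _ := h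
      _ ≤ _ := by
        have : 0 ≤ 1 + ((q : ℝ) - 1) * Real.exp (-δ) := by
          have : 0 ≤ (q : ℝ) - 1 := by linarith
          positivity
        gcongr
  rw [Real.exp_neg, ← div_eq_mul_inv, div_le_iff₀ (Real.exp_pos _)] at hE
  refine hE.trans (le_of_eq ?_)
  rw [mul_pow, ← Real.exp_nat_mul, ← Real.exp_nat_mul]
  have hexp : Real.exp ((n : ℝ) * -(ρ * δ / (1 + δ))) * Real.exp (δ * ((ρ - δ) * n + 1)) =
      Real.exp δ * Real.exp (n * -κ) := by
    rw [← Real.exp_add, ← Real.exp_add]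
    congr 1
    rw [hκ]
    field_simp
    ring
  linear_combination (q : ℝ) * (q : ℝ) ^ n * hexp

theorem maxCodeSize_limsup_le {q : ℕ} (a b : ℕ) (hq : 2 ≤ q) {δ : ℝ} (hδ : 0 < δ)
    (hδ' : δ < ((q : ℝ) - 1) / q) :
    limsup (fun n => ((maxCodeSize q n a b / codeBound q (a + b) b n : ℝ) : EReal)) atTop ≤
      (((((q : ℝ) - 1) / q) / (((q : ℝ) - 1) / q - δ)) ^ a : ℝ) := by
  classical
  have hq' : (2 : ℝ) ≤ q := by exact_mod_cast hq
  have hq1 : (0 : ℝ) < (q : ℝ) - 1 := by linarith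
  obtain ⟨c, θ, hθ0, hθ1, hE⟩ := exists_card_changes_lt_le hq hδ hδ'
  set ρ : ℝ := ((q : ℝ) - 1) / q with hρ
  clear_value ρ
  have hρδ : 0 < ρ - δ := by linarith
  set s := a + b with hs
  set R : ℕ → ℕ := fun n => (n.sqrt + 2) * s with hR
  set k : ℕ → ℕ := fun n => ⌈(ρ - δ) * n⌉₊ with hk
  have hRt : Tendsto (fun n => (R n : ℝ) / n) atTop (𝓝 0) := by
    have := (tendsto_sqrt_div.add (tendsto_const_div_atTop_nhds_zero_nat 2)).mul_const (s : ℝ)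
    rw [add_zero, zero_mul] at this
    refine this.congr fun n => ?_
    simp only [hR]
    push_cast
    ring
  have hkt : Tendsto (fun n => (k n : ℝ) / n) atTop (𝓝 (ρ - δ)) :=
    (tendsto_nat_ceil_mul_div_atTop hρδ.le).comp tendsto_natCast_atTop_atTop
  have hidt : Tendsto (fun n : ℕ => (n : ℝ) / n) atTop (𝓝 1) :=
    tendsto_const_nhds.congr' ((eventually_ne_atTop 0).mono fun n hn => by
      simp [hn])
  have hA := tendsto_choose_div_pow (tendsto_natSub_div hkt hRt) a
  have hB := tendsto_choose_div_pow (tendsto_natSub_div hidt hRt) b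
  have hS := tendsto_choose_div_pow hidt s
  have hfac : ((s.choose b : ℕ) : ℝ) * (a.factorial * b.factorial) = s.factorial := by
    have := Nat.add_choose_mul_factorial_mul_factorial a b
    rw [← mul_assoc]
    exact_mod_cast this
  set K : ℝ := ((q : ℝ) - 1) ^ s * s.choose b with hK
  have hK0 : 0 ≤ K := by positivity
  -- Normalized contributions of codewords with periodic stretches, of those with few changes, and
  -- of the packed rest.
  set u₁ : ℕ → ℝ := fun n => K * ((n : ℝ) ^ (s + 1) * (q : ℝ)⁻¹ ^ n.sqrt)
  set u₂ : ℕ → ℝ := fun n => K * c * ((n : ℝ) ^ s * θ ^ n)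
  set u₃ : ℕ → ℝ := fun n => ρ ^ a * s.choose b * ((n.choose s : ℝ) / (n : ℝ) ^ s) /
    (((k n - R n).choose a : ℝ) / (n : ℝ) ^ a * (((n - R n).choose b : ℝ) / (n : ℝ) ^ b))
  have hu₁ : Tendsto u₁ atTop (𝓝 0) := by
    have := (tendsto_pow_mul_inv_pow_sqrt (q := q) (by linarith) (s + 1)).const_mul K
    rwa [mul_zero] at this
  have hu₂ : Tendsto u₂ atTop (𝓝 0) := by
    simpa using (tendsto_pow_const_mul_const_pow_of_abs_lt_one s
      (by rwa [abs_of_pos hθ0])).const_mul (K * c)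
  have hAB : 0 < (ρ - δ) ^ a / a.factorial * ((1 : ℝ) ^ b / b.factorial) := by positivity
  have hu₃ : Tendsto u₃ atTop (𝓝 ((ρ / (ρ - δ)) ^ a)) := by
    have := (hS.const_mul (ρ ^ a * s.choose b)).div (hA.mul hB) hAB.ne'
    refine (this.congr fun n => rfl).trans (le_of_eq ?_)
    congr 1
    rw [← hfac]
    have h₁ : (a.factorial : ℝ) ≠ 0 := by positivity
    have h₂ : (b.factorial : ℝ) ≠ 0 := by positivity
    have h₃ : (s.choose b : ℝ) ≠ 0 := by
      exact_mod_cast (Nat.choose_pos (by omega)).ne'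
    rw [div_pow, one_pow, one_pow]
    field_simp
  have hlim : Tendsto (fun n => u₁ n + u₂ n + u₃ n) atTop (𝓝 ((ρ / (ρ - δ)) ^ a)) := by
    simpa using (hu₁.add hu₂).add hu₃
  rw [← ((continuous_coe_real_ereal.tendsto _).comp hlim).limsup_eq]
  refine limsup_le_limsup ?_
  -- Eventually both binomials are positive, so the packing inequality can be divided by `N`; `n >
  -- s` keeps `n - a` untruncated.
  filter_upwards [(hA.mul hB).eventually (lt_mem_nhds hAB), eventually_ge_atTop (s + 1)]
    with n hN hn
  simp only [Function.comp_apply, EReal.coe_le_coe_iff]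
  have hn0 : (0 : ℝ) < n := by exact_mod_cast (by omega : 0 < n)
  have hmain := maxCodeSize_mul_le q n a b n.sqrt (k n)
  rw [← hs] at hmain
  change _ * ((q - 1) ^ b * (k n - R n).choose a * (n - R n).choose b) ≤ _ *
    ((q - 1) ^ b * (k n - R n).choose a * (n - R n).choose b) + _ at hmain
  have hT₁ := card_not_noAlternation_le (α := Fin q) n.sqrt n
  rw [Fintype.card_fin] at hT₁
  set A₁ : ℕ := Finset.card {x : List.Vector (Fin q) n | ¬ NoAlternation n.sqrt x.toList}
  set A₂ : ℕ := Finset.card {x : List.Vector (Fin q) n | changes x.toList < k n}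
  have hT₁' : (A₁ : ℝ) ≤ n * ((q : ℝ) ^ n * (q : ℝ)⁻¹ ^ n.sqrt) := by
    have : (q : ℝ) ^ (n - n.sqrt) = (q : ℝ) ^ n * (q : ℝ)⁻¹ ^ n.sqrt := by
      rw [pow_sub₀ _ (by positivity) n.sqrt_le_self, inv_pow]
    rw [← this]
    exact_mod_cast hT₁
  have hT₂ : (A₂ : ℝ) ≤ c * θ ^ n * (q : ℝ) ^ n := hE n
  set A : ℝ := ((k n - R n).choose a : ℝ)
  set B : ℝ := ((n - R n).choose b : ℝ)
  have hAB' : 0 < A * B := by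
    rw [← mul_div_mul_comm] at hN
    by_contra! hle
    exact hN.not_ge (div_nonpos_of_nonpos_of_nonneg hle (by positivity))
  set N : ℝ := ((q : ℝ) - 1) ^ b * A * B
  have hN0 : 0 < N := by
    rw [show N = ((q : ℝ) - 1) ^ b * (A * B) from mul_assoc _ _ _]
    positivity
  have hmain' : (maxCodeSize q n a b : ℝ) * N ≤ (A₁ + A₂) * N + (q : ℝ) ^ (n - a + b) := by
    have : (((q - 1 : ℕ) : ℝ)) = (q : ℝ) - 1 := by
      rw [Nat.cast_sub (by omega), Nat.cast_one]
    simp only [N, A, B, ← this]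
    exact_mod_cast hmain
  have hV : (maxCodeSize q n a b : ℝ) ≤ A₁ + A₂ + (q : ℝ) ^ (n - a + b) / N := by
    rw [← sub_le_iff_le_add', le_div_iff₀ hN0]
    linarith
  have hDle : K * n.choose s / (q : ℝ) ^ (n + b) ≤ K * (n : ℝ) ^ s / (q : ℝ) ^ n := by
    gcongr
    · exact_mod_cast Nat.choose_le_pow n s
    · linarith
    · omega
  have h₃ : (q : ℝ) ^ (n - a + b) / N * (K * n.choose s / (q : ℝ) ^ (n + b)) = u₃ n := by
    have hq0 : (q : ℝ) ≠ 0 := by positivity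
    have hpow : (q : ℝ) ^ (n + b) = (q : ℝ) ^ (n - a + b) * (q : ℝ) ^ a := by
      rw [← pow_add]; congr 1; omega
    have hA0 : A ≠ 0 := left_ne_zero_of_mul hAB'.ne'
    have hB0 : B ≠ 0 := right_ne_zero_of_mul hAB'.ne'
    have hu : u₃ n = ρ ^ a * s.choose b * ((n.choose s : ℝ) / (n : ℝ) ^ s) /
      (A / (n : ℝ) ^ a * (B / (n : ℝ) ^ b)) := rfl
    have hNe : N = ((q : ℝ) - 1) ^ b * A * B := rfl
    have hns : (n : ℝ) ^ s = (n : ℝ) ^ a * (n : ℝ) ^ b := pow_add _ _ _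
    have hqs : ((q : ℝ) - 1) ^ s = ((q : ℝ) - 1) ^ a * ((q : ℝ) - 1) ^ b := pow_add _ _ _
    rw [hu, hNe, hK, hρ, hpow, hns, hqs, div_pow]
    clear_value A B
    field_simp
  calc (maxCodeSize q n a b : ℝ) / codeBound q s b n
      = maxCodeSize q n a b * (K * n.choose s / (q : ℝ) ^ (n + b)) := by
        rw [codeBound, div_div_eq_mul_div, hK]
        ring
    _ ≤ (A₁ + A₂ + (q : ℝ) ^ (n - a + b) / N) * (K * n.choose s / (q : ℝ) ^ (n + b)) := by
        gcongr
    _ = (A₁ + A₂) * (K * n.choose s / (q : ℝ) ^ (n + b)) + u₃ n := by rw [add_mul, h₃]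
    _ ≤ (A₁ + A₂) * (K * (n : ℝ) ^ s / (q : ℝ) ^ n) + u₃ n := by gcongr
    _ ≤ (n * ((q : ℝ) ^ n * (q : ℝ)⁻¹ ^ n.sqrt) + c * θ ^ n * (q : ℝ) ^ n) *
          (K * (n : ℝ) ^ s / (q : ℝ) ^ n) + u₃ n := by gcongr
    _ = u₁ n + u₂ n + u₃ n := by
        have hq0 : (q : ℝ) ^ n ≠ 0 := by positivity
        simp only [u₁, u₂]
        field_simp
        ring

theorem asympLE_maxCodeSize {q : ℕ} (a b : ℕ) (hq : 2 ≤ q) :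
    AsympLE (fun n => (maxCodeSize q n a b : ℝ)) (codeBound q (a + b) b) := by
  have hq' : (2 : ℝ) ≤ q := by exact_mod_cast hq
  set ρ : ℝ := ((q : ℝ) - 1) / q with hρ
  have hρ0 : 0 < ρ := div_pos (by linarith) (by linarith)
  -- The limsup does not depend on `δ`, so it is at most the limit of its upper bounds.
  have hlim : Tendsto (fun δ : ℝ => (((ρ / (ρ - δ)) ^ a : ℝ) : EReal)) (𝓝[>] 0) (𝓝 1) := by
    have h : ContinuousAt (fun δ : ℝ => (ρ / (ρ - δ)) ^ a) 0 :=
      (continuousAt_const.div (by fun_prop) (by simpa using hρ0.ne')).pow a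
    have h' := (continuous_coe_real_ereal.tendsto _).comp (h.tendsto.mono_left
      (nhdsWithin_le_nhds (s := Set.Ioi 0)))
    simpa [div_self hρ0.ne', Function.comp_def] using h'
  refine ge_of_tendsto hlim ?_
  filter_upwards [Ioo_mem_nhdsGT hρ0] with δ hδ
  exact maxCodeSize_limsup_le a b hq hδ.1 hδ.2

end MainBound

theorem mainTheorem1 (q a b : ℕ) (hq : 2 ≤ q) :
    -- the asymptotic upper bound for codes correcting `a` deletions and `b` insertions
    AsympLE (fun n => (maxCodeSize q n a b : ℝ)) (codeBound q (a + b) b) ∧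
    -- these codes are exactly the `(a + b)`-deletion correcting codes
    (∀ n : ℕ, a + b ≤ n → ∀ C : Finset (List.Vector (Fin q) n),
      IsCorrectingCode q n a b C ↔ IsCorrectingCode q n (a + b) 0 C) ∧
    -- so the same bound holds for them
    AsympLE (fun n => (maxCodeSize q n (a + b) 0 : ℝ)) (codeBound q (a + b) b) ∧
    -- the case of no insertions: Levenshtein's bound
    AsympLE (fun n => (maxCodeSize q n (a + b) 0 : ℝ))
      (fun n => (q : ℝ) ^ n / (((q : ℝ) - 1) ^ (a + b) * (n.choose (a + b) : ℝ))) ∧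
    -- for more than `q` errors, one insertion gives a strictly better bound than none
    (q < a + b → ∀ n : ℕ, a + b ≤ n →
      codeBound q (a + b) 1 n <
        (q : ℝ) ^ n / (((q : ℝ) - 1) ^ (a + b) * (n.choose (a + b) : ℝ))) := by
  have hq' : (2 : ℝ) ≤ q := by exact_mod_cast hq
  refine ⟨asympLE_maxCodeSize a b hq, fun n hn C => isCorrectingCode_iff_deletion hn C, ?_, ?_,
    fun hs n hn => ?_⟩
  · have h := asympLE_maxCodeSize a b hq
    unfold AsympLE at h ⊢
    rwa [limsup_congr ((eventually_ge_atTop (a + b)).mono fun n hn => by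
      beta_reduce
      rw [maxCodeSize_eq_deletion hn])] at h
  · simpa [codeBound, AsympLE] using asympLE_maxCodeSize (a + b) 0 hq
  · have h₁ : (0 : ℝ) < ((q : ℝ) - 1) ^ (a + b) * (n.choose (a + b) : ℝ) := by
      have : 0 < n.choose (a + b) := Nat.choose_pos hn
      have : (0 : ℝ) < (q : ℝ) - 1 := by linarith
      positivity
    have h₂ : (q : ℝ) < ((a + b : ℕ) : ℝ) := by exact_mod_cast hs
    unfold codeBound
    rw [Nat.choose_one_right, div_lt_div_iff₀ (mul_pos h₁ (by linarith)) h₁, pow_succ]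
    have h₃ : 0 < (q : ℝ) ^ n * (((q : ℝ) - 1) ^ (a + b) * (n.choose (a + b) : ℝ)) := by
      positivity
    nlinarith
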